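/- \textbf{Private information delivery (PID).} Let $K,N,M$ be natural numbers with $1\le M\le K$. A PID code consists of a prime $p$, a message length $L\ge 1$, a storage design $\mathcal S_1,\dots,\mathcal S_N\subseteq\{1,\dots,K\}$ with $|\mathcal S_n|=M$, the law of a random variable $Z$ on a finite set, answer lengths $D_1,\dots,D_N\ge 0$, and, for all $k\in\{1,\dots,K\}$ and $n\in\{1,\dots,N\}$, an answer $A_n^{[k]}\in\mathbb F_p^{D_n}$ which is a function of $(W_i)_{i\in\mathcal S_n}$ and $Z$. Here the messages $W_1,\dots,W_K$ are independent and uniform on $\mathbb F_p^L$, and $Z$ is independent of $(W_1,\dots,W_K)$. The code has to satisfy, for all $j,k\in\{1,\dots,K\}$, \begin{itemize} \item zero-error decoding: $W_k$ is almost surely a function of $(A_1^{[k]},\dots,A_N^{[k]})$, i.e. $H(W_k\mid A_1^{[k]},\dots,A_N^{[k]})=0$; \item privacy: $(A_1^{[j]},\dots,A_N^{[j]},W_j)$ and $(A_1^{[k]},\dots,A_N^{[k]},W_k)$ are identically distributed. \end{itemize} Its rate is $L/\sum_{n=1}^N D_n$. A real number $R$ is achievable if some PID code has rate at least $R$, and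 the capacity $C=C(K,N,M)$ is the supremum of the achievable $R$ (over all storage designs and all codes). \textbf{Theorem.} Suppose that $K/M$ is not an integer and $$\left\lceil \tfrac KM\right\rceil < N < \frac{K}{\gcd(K,M)}-\left(\frac{M}{\gcd(K,M)}-1\right)\left(\left\lfloor \tfrac KM\right\rfloor-1\right).$$ Then $$C\ \ge\ \frac{l}{N+(l-1)\left(\lfloor K/M\rfloor-1\right)},\qquad\text{where } l=\left\lfloor\frac{(N-\lfloor K/M\rfloor+1)\,M}{K-(\lfloor K/M\rfloor-1)\,M}\right\rfloor .$$ -/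

import Mathlib

/-- The data of a private information delivery (PID) code with `K` messages, `N` servers and
`M` messages stored per server. -/
structure PIDCode (K N M : ℕ) where
  /-- The order of the prime field `𝔽_p` of message and answer symbols. -/
  p : ℕ
  p_prime : Fact p.Prime
  /-- The number of symbols of each message. -/
  L : ℕ
  L_pos : 0 < L
  /-- The set of indices of the messages stored at each server. -/
  store : Fin N → Finset (Fin K)
  card_store : ∀ n, (store n).card = M
  /-- The (finite) alphabet of the common random variable `Z` shared by the servers. -/
  Rand : Type
  rand_finite : Finite Rand
  /-- The distribution of the common random variable `Z`. -/
  randLaw : PMF Rand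
  /-- The number of symbols sent by each server to the user. -/
  D : Fin N → ℕ
  /-- `answer k n s z` is what server `n` sends when message `k` is to be delivered, as a function
  of the messages `s` stored at server `n` and of the value `z` of `Z`. -/
  answer : Fin K → (n : Fin N) → (store n → (Fin L → ZMod p)) → Rand → (Fin (D n) → ZMod p)

namespace PIDCode

attribute [instance] PIDCode.p_prime

variable {K N M : ℕ} (c : PIDCode K N M)

/-- A single message: `L` symbols of `𝔽_p`. -/
abbrev Msg : Type := Fin c.L → ZMod c.p

/-- The sample space: all the messages `W_1, …, W_K`, and the common randomness `Z`. -/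
abbrev Sample : Type := (Fin K → c.Msg) × c.Rand

/-- The collection of the answers of all servers. -/
abbrev Answers : Type := (n : Fin N) → Fin (c.D n) → ZMod c.p

/-- The joint law of `(W_1, …, W_K, Z)`: the `K * L` message symbols are i.i.d. uniform on `𝔽_p`,
i.e. `(W_1, …, W_K)` is uniform, and `Z` is drawn independently of the messages. -/
noncomputable def law : PMF c.Sample :=
  (PMF.uniformOfFintype (Fin K → c.Msg)).bind fun w => c.randLaw.map fun z => (w, z)

/-- The answers `(A_1^[k], …, A_N^[k])` received by the user when message `k` is delivered. -/
def answers (k : Fin K) (ω : c.Sample) : c.Answers :=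
  fun n => c.answer k n (fun i => ω.1 i) ω.2

/-- Zero-error decoding: whichever message `k` is delivered, with probability one `W_k` is a
function of the answers. -/
def Correct : Prop :=
  ∀ k : Fin K, ∃ dec : c.Answers → c.Msg, ∀ ω ∈ c.law.support, dec (c.answers k ω) = ω.1 k

/-- Privacy: the joint law of the answers and the delivered message, `(A_1^[k], …, A_N^[k], W_k)`,
does not depend on `k`. -/
def Private : Prop :=
  ∀ j k : Fin K, c.law.map (fun ω => (c.answers j ω, ω.1 j)) =
    c.law.map (fun ω => (c.answers k ω, ω.1 k))

/-- The rate: delivered message symbols per downloaded symbol. -/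
noncomputable def rate : ℝ := (c.L : ℝ) / ∑ n, (c.D n : ℝ)

end PIDCode

/-- The rate `R` is achievable if some correct and private PID code, with any storage design, has
rate at least `R`. -/
def PIDAchievable (K N M : ℕ) (R : ℝ) : Prop :=
  ∃ c : PIDCode K N M, c.Correct ∧ c.Private ∧ R ≤ c.rate

/-- The capacity: the supremum of the achievable rates. -/
noncomputable def PIDCapacity (K N M : ℕ) : ℝ := sSup {R : ℝ | PIDAchievable K N M R}

/-! If the answers are uniform and the user always applies one fixed linear map `dec`, privacy is
automatic: the joint law is that of `(a, dec a)`. So it suffices that `dec` stays onto when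
restricted to the servers holding any given message (`exists_of_linear_decoder`). Put Q = ⌊K/M⌋ - 1,
P = K - QM, n = N - Q; then M ≤ P < 2M and l = ⌊nM/P⌋. Each of QM messages lies on a server sending
l symbols. Each of the other P lies on l of n one-symbol servers, whose columns in `dec` are
Vandermonde and hence span. The download is Ql + n. -/

/-- A surjective homomorphism of finite groups sends the uniform law to the uniform law. -/
theorem PMF.map_uniformOfFintype_of_surjective {G H : Type*} [AddCommGroup G] [Fintype G]
    [AddCommGroup H] [Fintype H] (f : G →+ H) (hf : Function.Surjective f) :
    (PMF.uniformOfFintype G).map f = PMF.uniformOfFintype H := by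
  classical
  -- All fibres are translates of the kernel, so they have equal mass; total mass one then fixes it.
  have hfib : ∀ y : H, (PMF.uniformOfFintype G).map f y = (PMF.uniformOfFintype G).map f 0 := by
    intro y
    obtain ⟨g, rfl⟩ := hf y
    rw [PMF.map_apply, PMF.map_apply, ← (Equiv.addRight g).tsum_eq]
    refine tsum_congr fun a => ?_
    simp only [Equiv.coe_addRight, map_add, PMF.uniformOfFintype_apply]
    congr 1
    simp [eq_comm]
  have hsum := ((PMF.uniformOfFintype G).map f).tsum_coe
  rw [tsum_fintype, Finset.sum_congr rfl fun y _ => hfib y, Finset.sum_const, nsmul_eq_mul,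
    Finset.card_univ] at hsum
  ext y
  rw [hfib y, PMF.uniformOfFintype_apply, ← ENNReal.eq_inv_of_mul_eq_one_left]
  rwa [mul_comm] at hsum

/-- The product of two uniform laws is uniform. -/
theorem PMF.uniformOfFintype_bind_map_prod {α β : Type*} [Fintype α] [Nonempty α] [Fintype β]
    [Nonempty β] :
    ((PMF.uniformOfFintype α).bind fun a => (PMF.uniformOfFintype β).map fun b => (a, b)) =
      PMF.uniformOfFintype (α × β) := by
  classical
  ext ⟨a, b⟩
  rw [PMF.bind_apply, tsum_eq_single a]
  · rw [PMF.map_apply, tsum_eq_single b]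
    · simp [ENNReal.mul_inv]
    · intro b' hb'
      simp [Ne.symm hb']
  · intro a' ha'
    simp [PMF.map_apply, Ne.symm ha']

namespace PIDCode

/-- A correct code downloads at least as many symbols as a message has. -/
theorem Correct.length_le {K N M : ℕ} {c : PIDCode K N M} (hc : c.Correct) (k : Fin K) :
    c.L ≤ ∑ n, c.D n := by
  classical
  obtain ⟨dec, hdec⟩ := hc k
  obtain ⟨z, hz⟩ := c.randLaw.support_nonempty
  have hsurj : Function.Surjective dec := by
    intro m
    refine ⟨c.answers k (fun _ => m, z), hdec _ ?_⟩
    rw [law, PMF.mem_support_bind_iff]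
    refine ⟨fun _ => m, by simp, ?_⟩
    rw [PMF.mem_support_map_iff]
    exact ⟨z, hz, rfl⟩
  have hcard := Fintype.card_le_of_surjective dec hsurj
  simp only [Fintype.card_pi, ZMod.card, Finset.prod_const, Finset.card_univ,
    Fintype.card_fin, Finset.prod_pow_eq_pow_sum] at hcard
  exact (Nat.pow_le_pow_iff_right c.p_prime.out.one_lt).mp hcard

theorem Correct.rate_le_one {K N M : ℕ} {c : PIDCode K N M} (hc : c.Correct) (k : Fin K) :
    c.rate ≤ 1 := by
  have h := hc.length_le k
  refine div_le_one_of_le₀ ?_ (by positivity)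
  exact_mod_cast h

/-- A linear decoder which is onto already on the answers supported on the servers holding
message `k`, for every `k`, is the decoder of a correct and private code: mask with uniform
answers `z` and correct by an answer, supported on those servers, that decodes to
`W_k - dec z`. -/
theorem exists_of_linear_decoder {K N M : ℕ} (p : ℕ) [hp : Fact p.Prime] {L : ℕ} (hL : 0 < L)
    (store : Fin N → Finset (Fin K)) (hstore : ∀ n, (store n).card = M) (D : Fin N → ℕ)
    (dec : ((n : Fin N) → Fin (D n) → ZMod p) →ₗ[ZMod p] (Fin L → ZMod p))
    (hdec : ∀ (k : Fin K) (w : Fin L → ZMod p), ∃ a, dec a = w ∧ ∀ n, k ∉ store n → a n = 0) :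
    ∃ c : PIDCode K N M, c.Correct ∧ c.Private ∧ c.rate = (L : ℝ) / ∑ n, (D n : ℝ) := by
  classical
  -- The correction is chosen linear in `w`, so that the answers are a homomorphic image of messages
  -- and mask.
  have hinv : ∀ k : Fin K, ∃ r : (Fin L → ZMod p) →ₗ[ZMod p] ((n : Fin N) → Fin (D n) → ZMod p),
      (∀ w, dec (r w) = w) ∧ ∀ w n, k ∉ store n → r w n = 0 := by
    intro k
    let S : Submodule (ZMod p) ((n : Fin N) → Fin (D n) → ZMod p) :=
      { carrier := {a | ∀ n, k ∉ store n → a n = 0}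
        add_mem' := fun ha hb n hn => by simp [ha n hn, hb n hn]
        zero_mem' := fun n _ => rfl
        smul_mem' := fun x a ha n hn => by simp [ha n hn] }
    have hsurj : Function.Surjective (dec.comp S.subtype) := fun w => by
      obtain ⟨a, ha, ha'⟩ := hdec k w
      exact ⟨⟨a, ha'⟩, ha⟩
    obtain ⟨g, hg⟩ := (dec.comp S.subtype).exists_rightInverse_of_surjective
      (LinearMap.range_eq_top.mpr hsurj)
    exact ⟨S.subtype.comp g, fun w => LinearMap.congr_fun hg w, fun w => (g w).2⟩
  choose r hr hr0 using hinv
  let c : PIDCode K N M :=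
    { p := p
      p_prime := hp
      L := L
      L_pos := hL
      store := store
      card_store := hstore
      Rand := (n : Fin N) → Fin (D n) → ZMod p
      rand_finite := inferInstance
      randLaw := PMF.uniformOfFintype _
      D := D
      answer := fun k n s z =>
        if h : k ∈ store n then z n + r k (s ⟨k, h⟩ - dec z) n else z n }
  have hans : ∀ k ω, c.answers k ω = ω.2 + r k (ω.1 k - dec ω.2) := by
    intro k ω
    funext n
    by_cases h : k ∈ store n
    · simp [answers, c, h]
    · simp [answers, c, h, hr0 k _ n h]
  have hval : ∀ k ω, dec (c.answers k ω) = ω.1 k := by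
    intro k ω
    rw [hans, map_add, hr, add_sub_cancel]
  have hunif : ∀ k, c.law.map (c.answers k) =
      PMF.uniformOfFintype ((n : Fin N) → Fin (D n) → ZMod p) := by
    intro k
    let f : (Fin K → Fin L → ZMod p) × ((n : Fin N) → Fin (D n) → ZMod p) →ₗ[ZMod p]
        ((n : Fin N) → Fin (D n) → ZMod p) :=
      LinearMap.snd _ _ _ +
        (r k).comp ((LinearMap.proj (φ := fun _ : Fin K => Fin L → ZMod p) k).comp
        (LinearMap.fst _ _ _) - dec.comp (LinearMap.snd _ _ _))
    -- If every message equals `dec a` and the mask is `a`, the correction vanishes.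
    have hf : Function.Surjective f.toAddMonoidHom := fun a =>
      ⟨(fun _ => dec a, a), by simp [f]⟩
    have hlaw : c.law = PMF.uniformOfFintype
        ((Fin K → Fin L → ZMod p) × ((n : Fin N) → Fin (D n) → ZMod p)) :=
      PMF.uniformOfFintype_bind_map_prod
    rw [← PMF.map_uniformOfFintype_of_surjective f.toAddMonoidHom hf, hlaw]
    congr 1
    funext ω
    exact hans k ω
  have hjoint : ∀ k, c.law.map (fun ω => (c.answers k ω, ω.1 k)) =
      (PMF.uniformOfFintype ((n : Fin N) → Fin (D n) → ZMod p)).map fun a => (a, dec a) := by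
    intro k
    rw [← hunif k, PMF.map_comp]
    congr 1
    funext ω
    exact Prod.ext rfl (hval k ω).symm
  exact ⟨c, fun k => ⟨dec, fun ω _ => hval k ω⟩, fun j k => (hjoint j).trans (hjoint k).symm, rfl⟩

end PIDCode

/-- A storage design: the first `Q` servers hold disjoint blocks of `M` messages, and each of the
other `P` messages is held by at least `l` of the other `n` servers, which are filled
cyclically. -/
theorem exists_cyclic_storage {M P Q n l : ℕ} (hM : 0 < M) (hMP : M ≤ P) (hl : l * P ≤ n * M) :
    ∃ store : Fin (Q + n) → Finset (Fin (Q * M + P)), (∀ i, (store i).card = M) ∧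
      ∀ k : Fin (Q * M + P), (∃ i, i.val < Q ∧ k ∈ store i) ∨
        ∃ e : Fin l → Fin (Q + n), Function.Injective e ∧ ∀ t, Q ≤ (e t).val ∧ k ∈ store (e t) := by
  classical
  have hP : 0 < P := hM.trans_le hMP
  -- Message in storage slot `x`; server `i` owns slots `i * M` to `i * M + M - 1`.
  let f : ℕ → Fin (Q * M + P) := fun x =>
    if h : x < Q * M then ⟨x, by omega⟩
    else ⟨Q * M + (x - Q * M) % P, Nat.add_lt_add_left (Nat.mod_lt _ hP) _⟩
  have hlt : ∀ x, x < Q * M → (f x).val = x := fun x hx => by simp [f, hx]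
  have hge : ∀ x, (f (Q * M + x)).val = Q * M + x % P := fun x => by simp [f]
  have hmem : ∀ x, f x ∈ (Finset.range M).image fun t => f (x / M * M + t) := fun x =>
    Finset.mem_image.mpr ⟨x % M, Finset.mem_range.mpr (Nat.mod_lt _ hM), by rw [Nat.div_add_mod']⟩
  refine ⟨fun i => (Finset.range M).image fun t => f (i.val * M + t), ?_, ?_⟩
  · intro i
    rw [Finset.card_image_of_injOn, Finset.card_range]
    intro s hs t ht hst
    simp only [Finset.coe_range, Set.mem_Iio] at hs ht
    have hst' := congrArg Fin.val hst
    dsimp only at hst'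
    rcases lt_or_ge i.val Q with hi | hi
    · have : (i.val + 1) * M ≤ Q * M := Nat.mul_le_mul_right _ hi
      rw [add_mul, one_mul] at this
      rw [hlt _ (by omega), hlt _ (by omega)] at hst'
      omega
    · obtain ⟨j, hj⟩ := Nat.exists_eq_add_of_le hi
      rw [hj, add_mul, add_assoc, add_assoc, hge, hge] at hst'
      have hmod : s ≡ t [MOD P] := Nat.ModEq.add_left_cancel' (j * M) (Nat.add_left_cancel hst')
      exact Nat.ModEq.eq_of_lt_of_lt hmod (by omega) (by omega)
  · intro k
    rcases lt_or_ge k.val (Q * M) with hk | hk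
    · have hdiv : k.val / M < Q := Nat.div_lt_of_lt_mul (hk.trans_eq (mul_comm _ _))
      have hfk : f k.val = k := Fin.ext (hlt _ hk)
      exact Or.inl ⟨⟨k.val / M, by omega⟩, hdiv, by simpa only [hfk] using hmem k.val⟩
    · obtain ⟨j, hj⟩ := Nat.exists_eq_add_of_le hk
      have hjP : j < P := by have := k.2; omega
      have hfk : ∀ t, f (Q * M + (j + t * P)) = k := fun t => Fin.ext (by
        rw [hge, Nat.add_mul_mod_self_right, Nat.mod_eq_of_lt hjP, hj])
      have hdiv : ∀ x, (Q * M + x) / M = Q + x / M := fun x => by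
        rw [add_comm, Nat.add_mul_div_right _ _ hM, add_comm]
      have hbound : ∀ t : Fin l, (Q * M + (j + t.val * P)) / M < Q + n := fun t => by
        rw [hdiv]
        refine Nat.add_lt_add_left (Nat.div_lt_of_lt_mul ?_) _
        have : (t.val + 1) * P ≤ l * P := Nat.mul_le_mul_right _ t.2
        rw [add_mul, one_mul] at this
        rw [mul_comm M n]
        omega
      -- Successive copies are `P ≥ M` slots apart, hence on different servers.
      have hmono : StrictMono fun t : ℕ => (Q * M + (j + t * P)) / M := by
        refine strictMono_nat_of_lt_succ fun t => ?_
        calc (Q * M + (j + t * P)) / M < (Q * M + (j + t * P)) / M + 1 := Nat.lt_succ_self _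
          _ = (Q * M + (j + t * P) + M) / M := (Nat.add_div_right _ hM).symm
          _ ≤ (Q * M + (j + (t + 1) * P)) / M :=
            Nat.div_le_div_right (by rw [add_mul, one_mul]; omega)
      refine Or.inr ⟨fun t => ⟨_, hbound t⟩, fun s t hst => ?_, fun t => ⟨?_, ?_⟩⟩
      · exact Fin.ext (hmono.injective (congrArg Fin.val hst))
      · exact (Nat.le_add_right _ _).trans_eq (hdiv _).symm
      · simpa only [hfk] using hmem (Q * M + (j + t.val * P))

/-- `l` columns of a Vandermonde matrix with distinct nodes span. -/
theorem exists_vandermonde_combination {F : Type*} [Field F] {l : ℕ} {x : Fin l → F}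
    (hx : Function.Injective x) (w : Fin l → F) :
    ∃ b : Fin l → F, ∀ i : Fin l, ∑ t, b t * x t ^ i.val = w i := by
  have hdet : IsUnit (Matrix.vandermonde x).det :=
    (Matrix.det_vandermonde_ne_zero_iff.mpr hx).isUnit
  refine ⟨Matrix.vecMul w (Matrix.vandermonde x)⁻¹, fun i => ?_⟩
  have h : Matrix.vecMul (Matrix.vecMul w (Matrix.vandermonde x)⁻¹) (Matrix.vandermonde x) = w := by
    rw [Matrix.vecMul_vecMul, Matrix.nonsing_inv_mul _ hdet, Matrix.vecMul_one]
  exact congrFun h i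

/-- The code in which the first `Q` servers answer with `l` symbols and the others with one. -/
theorem PIDCode.exists_of_cyclic_storage {M P Q n l : ℕ} (hM : 0 < M) (hMP : M ≤ P) (hl0 : 0 < l)
    (hl : l * P ≤ n * M) :
    ∃ c : PIDCode (Q * M + P) (Q + n) M, c.Correct ∧ c.Private ∧
      c.rate = (l : ℝ) / ((Q : ℝ) * l + n) := by
  classical
  obtain ⟨store, hcard, hcover⟩ := exists_cyclic_storage (Q := Q) hM hMP hl
  -- A prime at least Q + n keeps the server indices, used as Vandermonde nodes, distinct mod `p`.
  obtain ⟨p, hp, hpp⟩ := Nat.exists_infinite_primes (Q + n)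
  have : Fact p.Prime := ⟨hpp⟩
  let D : Fin (Q + n) → ℕ := fun i => if i.val < Q then l else 1
  let G : Fin (Q + n) → ℕ → Fin l → ZMod p := fun i d m =>
    if i.val < Q then (if d = m.val then 1 else 0) else (i.val : ZMod p) ^ m.val
  let dec : ((i : Fin (Q + n)) → Fin (D i) → ZMod p) →ₗ[ZMod p] (Fin l → ZMod p) :=
    { toFun := fun a m => ∑ i, ∑ d, a i d * G i d.val m
      map_add' := fun a b => by
        funext m
        simp [add_mul, Finset.sum_add_distrib]
      map_smul' := fun x a => by
        funext m
        simp [mul_assoc, Finset.mul_sum] }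
  have hdec : ∀ (k : Fin (Q * M + P)) (w : Fin l → ZMod p), ∃ a, dec a = w ∧ ∀ i, k ∉ store i → a i = 0 := by
    intro k w
    rcases hcover k with ⟨i, hi, hk⟩ | ⟨e, he, hek⟩
    · have hD : D i = l := if_pos hi
      refine ⟨Pi.single i fun d => w (Fin.cast hD d), ?_, fun j hj => ?_⟩
      · funext m
        change ∑ j, ∑ d : Fin (D j), _ = _
        rw [Finset.sum_eq_single i]
        · rw [Finset.sum_eq_single (Fin.cast hD.symm m)]
          · simp [G, hi]
          · intro d _ hd
            have : d.val ≠ m.val := fun h => hd (Fin.ext h)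
            simp [G, hi, this]
          · simp
        · intro j _ hj
          simp [Pi.single_eq_of_ne hj]
        · simp
      · refine Pi.single_eq_of_ne (fun h => hj ?_) _
        rwa [h]
    · have hx : Function.Injective fun t => ((e t).val : ZMod p) := fun s t hst => by
        refine he (Fin.ext ?_)
        have h := (ZMod.natCast_eq_natCast_iff _ _ _).mp hst
        exact Nat.ModEq.eq_of_lt_of_lt h ((e s).2.trans_le hp) ((e t).2.trans_le hp)
      obtain ⟨b, hb⟩ := exists_vandermonde_combination hx w
      refine ⟨fun i _ => ∑ t, if e t = i then b t else 0, ?_, fun i hi => ?_⟩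
      · funext m
        change ∑ j, ∑ d : Fin (D j), _ = _
        rw [← hb m]
        have hinner : ∀ i : Fin (Q + n), (∑ d : Fin (D i), (∑ t, if e t = i then b t else 0) *
            G i d.val m) = ∑ t, if e t = i then b t * ((e t).val : ZMod p) ^ m.val else 0 := by
          intro i
          by_cases hi : i.val < Q
          · have hne : ∀ t, e t ≠ i := fun t h => by
              have := (hek t).1
              rw [h] at this
              omega
            simp [hne]
          · have hD : D i = 1 := if_neg hi
            simp only [G, if_neg hi, Finset.sum_const, Finset.card_univ, Fintype.card_fin, hD,
              one_smul, Finset.sum_mul]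
            refine Finset.sum_congr rfl fun t _ => ?_
            split_ifs with h
            · rw [h]
            · rw [zero_mul]
        rw [Finset.sum_congr rfl fun i _ => hinner i, Finset.sum_comm]
        simp
      · funext d
        refine Finset.sum_eq_zero fun t _ => if_neg fun h => hi ?_
        rw [← h]
        exact (hek t).2
  obtain ⟨c, hc, hpriv, hrate⟩ := exists_of_linear_decoder p hl0 store hcard D dec hdec
  refine ⟨c, hc, hpriv, ?_⟩
  rw [hrate, Fin.sum_univ_add]
  simp [D]

/-- The rate bound 1 is essential: `sSup` of a set unbounded above is 0 in ℝ. -/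
theorem PIDAchievable.le_capacity {K N M : ℕ} {R : ℝ} (hK : 0 < K) (h : PIDAchievable K N M R) :
    R ≤ PIDCapacity K N M :=
  le_csSup ⟨1, fun _ ⟨_, hc, _, hR⟩ => hR.trans (hc.rate_le_one ⟨0, hK⟩)⟩ h

theorem theorem3 (K N M : ℕ) (hM : 1 ≤ M) (hMK : M ≤ K)
    (hKM : ¬ ∃ z : ℤ, (K : ℝ) / (M : ℝ) = (z : ℝ))
    (hN_lower : ⌈(K : ℝ) / (M : ℝ)⌉ < (N : ℤ))
    (hN_upper : (N : ℝ) < (K : ℝ) / (Nat.gcd K M : ℝ) -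
      ((M : ℝ) / (Nat.gcd K M : ℝ) - 1) * ((⌊(K : ℝ) / (M : ℝ)⌋ : ℝ) - 1))
    (l : ℤ)
    (hl : l = ⌊((N : ℝ) - (⌊(K : ℝ) / (M : ℝ)⌋ : ℝ) + 1) * (M : ℝ) /
      ((K : ℝ) - ((⌊(K : ℝ) / (M : ℝ)⌋ : ℝ) - 1) * (M : ℝ))⌋) :
    PIDCapacity K N M ≥
      (l : ℝ) / ((N : ℝ) + ((l : ℝ) - 1) * ((⌊(K : ℝ) / (M : ℝ)⌋ : ℝ) - 1)) := by
  have hfloor : ⌊(K : ℝ) / (M : ℝ)⌋ = ((K / M : ℕ) : ℤ) := by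
    rw [← Int.natCast_floor_eq_floor (by positivity), Nat.floor_div_eq_div]
  have hqN : K / M < N := by
    have := (Int.floor_le_ceil ((K : ℝ) / M)).trans_lt hN_lower
    rw [hfloor] at this
    exact_mod_cast this
  obtain ⟨Q, hQ⟩ : ∃ Q, K / M = Q + 1 := ⟨K / M - 1, by have := Nat.div_pos hMK hM; omega⟩
  obtain ⟨n, rfl⟩ : ∃ n, N = Q + n := ⟨N - Q, by omega⟩
  have hmod := Nat.div_add_mod' K M
  have hmodlt := Nat.mod_lt K hM
  obtain ⟨P, rfl, hMP, hP2⟩ : ∃ P, K = Q * M + P ∧ M ≤ P ∧ P < 2 * M := by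
    rw [hQ, add_mul, one_mul] at hmod
    exact ⟨M + K % M, by omega, by omega, by omega⟩
  rw [hfloor, hQ] at hl
  rw [hfloor, hQ]
  push_cast at hl ⊢
  have hMpos : (0 : ℝ) < M := by exact_mod_cast hM
  have hPpos : (0 : ℝ) < P := by exact_mod_cast (by omega : 0 < P)
  have hl' : l = ⌊((n * M : ℕ) : ℝ) / (P : ℕ)⌋ := by
    rw [hl]
    push_cast
    congr 1
    congr 1 <;> ring
  rw [← Int.natCast_floor_eq_floor (by positivity), Nat.floor_div_eq_div] at hl'
  subst hl'
  have hn : 2 ≤ n := by omega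
  -- P < 2M ≤ nM.
  have hl0 : 0 < n * M / P := by
    refine Nat.div_pos ?_ (by omega)
    have := Nat.mul_le_mul_right M hn
    omega
  obtain ⟨c, hc, hpriv, hrate⟩ := PIDCode.exists_of_cyclic_storage (Q := Q) hM hMP hl0
    (Nat.div_mul_le_self (n * M) P)
  refine PIDAchievable.le_capacity (by omega) ⟨c, hc, hpriv, ?_⟩
  rw [hrate, Int.cast_natCast]
  refine le_of_eq ?_
  congr 1
  ring
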